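/- For $\gamma>0$ let $PW_\gamma$ be the space of all $f\in L^2(\mathbb R)$ with $\hat f(\omega)=\int f(x)e^{-i\omega x}\,dx=0$ for a.e. $\omega\in\mathbb R\setminus[-\gamma,\gamma]$; its elements are identified with their continuous representatives (which extend to entire functions). A sequence $(t_n)_{n\in\mathbb Z}\subset\mathbb R$ is a \emph{set of sampling} for $PW_\gamma$ if there are constants $A,B>0$ such that $A\|f\|^2\le\sum_n|f(t_n)|^2\le B\|f\|^2$ for all $f\in PW_\gamma$. The \emph{Beurling density} of $X\subseteq\mathbb R$ is $\mathcal D(X)=\lim_{h\to\infty}\inf_{x\in\mathbb R}\#(X\cap[x,x+h])/h\in[0,\infty]$, if this limit exists. A $K\times M$ complex matrix $V=[\vec v_0\ \cdots\ \vec v_{M-1}]$ \emph{does phase retrieval on $\mathbb C^K$} if, for $\vec x,\vec y\in\mathbb C^K$, $|\langle\vec x,\vec v_m\rangle|=|\langle\vec y,\vec v_m\rangle|$ for all $m$ implies $\vec x=e^{i\theta}\vec y$ for some $\theta\in\mathbb R$. Given $b_0,\dots,b_{K-1}\in\mathbb R$, put $\vec v*f=\sum_{k=0}^{K-1}\overline{v_k}\,f(\cdot+b_k)$.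 \textbf{Theorem.} Let $K\ge1$ and let $V=[\vec v_0\ \cdots\ \vec v_{M-1}]$ be a $K\times M$ complex matrix which does phase retrieval on $\mathbb C^K$. Let $b_0,\dots,b_{K-1}\in\mathbb R$ be such that the subgroup of $\mathbb R$ generated by the differences $b_k-b_0$, $0\le k\le K-1$ (if $b_0=0$, this is the group $\mathbb Z(b_0,\dots,b_{K-1})$ generated by the $b_k$), has Beurling density greater than one. Suppose $(t_n)_{n\in\mathbb Z}\subset\mathbb R$ is a set of sampling for $PW_{2\pi}$. Then the samples $$\{|\vec v_m*f(t_n)| : m=0,\dots,M-1;\ n\in\mathbb Z\}$$ do phase retrieval on $PW_\pi$: if $f,g\in PW_\pi$ satisfy $|\vec v_m*f(t_n)|=|\vec v_m*g(t_n)|$ for all $m$ and all $n$, then $f=\lambda g$ for some $\lambda\in\mathbb C$ with $|\lambda|=1$. -/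

import Mathlib

open MeasureTheory Filter Topology
open scoped ENNReal FourierTransform Matrix

noncomputable section

/-- The Paley-Wiener space `PW_γ`: square-integrable functions whose Fourier transform
`∫ f(x) e^{-iωx} dx` vanishes for almost every real `ω` outside `[-γ, γ]`. Every such `L²` class has
exactly one continuous representative (the restriction to `ℝ` of its entire extension), and that
representative is the element of the set, so that point evaluations make sense.
Mathlib's `𝓕` is normalized with the kernel `e^{-2πixξ}`, so `ω = 2πξ`. -/
def PaleyWiener (γ : ℝ) : Set (ℝ → ℂ) :=
  {f | Continuous f ∧ ∃ hf : MemLp f 2 (volume : Measure ℝ),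
    ∀ᵐ ξ : ℝ, 2 * Real.pi * ξ ∉ Set.Icc (-γ) γ →
      (𝓕 (hf.toLp f) : Lp ℂ 2 (volume : Measure ℝ)) ξ = 0}

/-- `(t_n)` is a set of sampling for `PW_γ`:
`A ‖f‖² ≤ ∑ |f(t_n)|² ≤ B ‖f‖²` with constants `A, B > 0` independent of `f`. -/
def IsSetOfSampling (γ : ℝ) (t : ℤ → ℝ) : Prop :=
  ∃ A B : ℝ, 0 < A ∧ 0 < B ∧ ∀ f ∈ PaleyWiener γ,
    Summable (fun n => ‖f (t n)‖ ^ 2) ∧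
    A * ∫ x, ‖f x‖ ^ 2 ≤ ∑' n, ‖f (t n)‖ ^ 2 ∧
    ∑' n, ‖f (t n)‖ ^ 2 ≤ B * ∫ x, ‖f x‖ ^ 2

/-- `X ⊆ ℝ` has Beurling density `D ∈ [0, ∞]`:
`D = lim_{h → ∞} inf_x #(X ∩ [x, x + h]) / h`. -/
def HasBeurlingDensity (X : Set ℝ) (D : ℝ≥0∞) : Prop :=
  Tendsto (fun h : ℝ =>
      ⨅ x : ℝ, ((X ∩ Set.Icc x (x + h)).encard : ℝ≥0∞) / ENNReal.ofReal h)
    atTop (𝓝 D)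

/-- The subgroup `ℤ(c_0, …, c_{K-1})` of `ℝ` generated by the numbers `c_k`. -/
def generatedGroup {K : ℕ} (c : Fin K → ℝ) : AddSubgroup ℝ :=
  AddSubgroup.closure (Set.range c)

/-- The columns `v_m` of `V` do phase retrieval on `ℂ^K`: if `|⟨x, v_m⟩| = |⟨y, v_m⟩|` for
all `m`, then `x = e^{iθ} y` for some real `θ`. Here `⟨x, v⟩ = ∑ x_k conj(v_k)`. -/
def MatrixDoesPhaseRetrieval {K M : ℕ} (V : Matrix (Fin K) (Fin M) ℂ) : Prop :=
  ∀ x y : Fin K → ℂ,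
    (∀ m, ‖x ⬝ᵥ star (V.col m)‖ = ‖y ⬝ᵥ star (V.col m)‖) →
      ∃ θ : ℝ, x = Complex.exp (θ * Complex.I) • y

/-- The structured convolution `v ∗ f = ∑_k conj(v_k) f(· + b_k)`. -/
def structuredConv {K : ℕ} (b : Fin K → ℝ) (v : Fin K → ℂ) (f : ℝ → ℂ) : ℝ → ℂ :=
  fun s => ∑ k, star (v k) * f (s + b k)

/-- The magnitudes of the measurements `φ i` determine every element of `S` up to a
unimodular constant. -/
def DoesPhaseRetrievalOn {ι : Type*} (S : Set (ℝ → ℂ)) (φ : ι → (ℝ → ℂ) → ℂ) : Prop :=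
  ∀ f ∈ S, ∀ g ∈ S, (∀ i, ‖φ i f‖ = ‖φ i g‖) → ∃ c : ℂ, ‖c‖ = 1 ∧ f = c • g

end

/-!
Let `f, g ∈ PW_π` have the same measurement magnitudes at the points `t n`. Every `u = v_m ∗ f` and
`w = v_m ∗ g` lies in `PW_π`, so `|u|² - |w|²` lies in `PW_{2π}`
(`PaleyWiener.mul_mem`, `PaleyWiener.star_mem`). It vanishes on a set of sampling for that space,
hence everywhere (`PaleyWiener.norm_eq_of_isSetOfSampling`). Phase retrieval by `V` then shows that
for every real `s` the vectors `(f (s + b k))_k` and `(g (s + b k))_k` differ by a phase. With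
`c k = b k - b 0` this gives `|f| = |g|` on the line and `f (s + c k) g s = f s g (s + c k)`: the
quotient `f / g` is periodic with respect to the group `G` generated by the `c k`.

The quotient need not be analysed as a meromorphic function. If `g ≠ 0`, its zero set is countable,
because `g` is analytic, and so is `G`; hence some coset `s + G` avoids all zeros of `g`
(`PaleyWiener.exists_forall_coset_ne_zero`). On this coset `f / g` is a constant `q` of modulus one,
so `f - q g ∈ PW_π` vanishes on `s + G`. A group of Beurling density greater than one is dense or
contains some `a` with `0 < a < 1`. In the dense case continuity gives `f = q g`. In the other case
`f - q g` is oversampled on `s + aℤ`: these samples are the Fourier coefficients of its spectrum on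
a circle of length `1 / a`, and Parseval's identity gives `f = q g`
(`PaleyWiener.eq_zero_of_eqOn_coset`).

Apart from linearity, the `L²` Fourier transform enters through its agreement with the
distributional one. This identifies the elements of `PW_γ` with the square-integrable
Fourier integrals of integrable spectra supported in the band
(`exists_eq_fourierInv_of_mem_paleyWiener`, `fourierInv_mem_paleyWiener`).
-/

/-! ### Paley-Wiener functions as Fourier integrals -/

/-- The distributional Fourier transform of `𝓕⁻ F` is `F`, tested against a Schwartz function:
Fubini moves the inverse transform from `F` onto `𝓕 φ`. -/
theorem integral_fourierInv_mul_fourier_schwartz {F : ℝ → ℂ} (hF : Integrable F)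
    (φ : SchwartzMap ℝ ℂ) :
    ∫ x, (𝓕 φ : SchwartzMap ℝ ℂ) x • 𝓕⁻ F x = ∫ ξ, φ ξ • F ξ := by
  have h := VectorFourier.integral_fourierIntegral_smul_eq_flip (e := Real.fourierChar)
    (μ := volume) (ν := volume) (L := - innerₗ ℝ) (f := F) (g := (𝓕 φ : SchwartzMap ℝ ℂ))
    Real.continuous_fourierChar (by
      simp only [LinearMap.neg_apply, innerₗ_apply_apply]
      fun_prop) hF (SchwartzMap.integrable _)
  have e1 : ∀ x, VectorFourier.fourierIntegral Real.fourierChar volume (-innerₗ ℝ) F x =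
      𝓕⁻ F x := by
    intro x; simp [VectorFourier.fourierIntegral, Real.fourierInv_eq]
  have e2 : ∀ ξ, VectorFourier.fourierIntegral Real.fourierChar volume
      (LinearMap.flip (-innerₗ ℝ)) (𝓕 φ : SchwartzMap ℝ ℂ) ξ = φ ξ := by
    intro ξ
    have : (𝓕⁻ (𝓕 φ : SchwartzMap ℝ ℂ) : SchwartzMap ℝ ℂ) ξ = φ ξ := by
      rw [FourierTransform.fourierInv_fourier_eq]
    rw [← this, SchwartzMap.fourierInv_coe]
    simp [VectorFourier.fourierIntegral, Real.fourierInv_eq, mul_comm]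
  simp only [e1, e2, smul_eq_mul] at h ⊢
  simpa [mul_comm] using h

theorem ae_eq_of_forall_schwartz {f g : ℝ → ℂ} (hf : LocallyIntegrable f)
    (hg : LocallyIntegrable g)
    (h : ∀ φ : SchwartzMap ℝ ℂ, ∫ x, φ x • f x = ∫ x, φ x • g x) : f =ᵐ[volume] g := by
  refine ae_eq_of_integral_contDiff_smul_eq hf hg fun u u_smooth u_cpt => ?_
  have hu₁ : HasCompactSupport (Complex.ofRealCLM ∘ u) := u_cpt.comp_left rfl
  have hu₂ := Complex.ofRealCLM.contDiff.comp u_smooth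
  simpa using h (hu₁.toSchwartzMap hu₂)

theorem continuous_fourierInv {F : ℝ → ℂ} (hF : Integrable F) : Continuous (𝓕⁻ F) := by
  have := VectorFourier.fourierIntegral_continuous (e := Real.fourierChar)
    (μ := volume) (L := - innerₗ ℝ) (f := F)
    Real.continuous_fourierChar (by
      simp only [LinearMap.neg_apply, innerₗ_apply_apply]
      fun_prop) hF
  convert this using 1
  ext x; simp [VectorFourier.fourierIntegral, Real.fourierInv_eq]

theorem norm_fourierInv_le (F : ℝ → ℂ) (x : ℝ) : ‖𝓕⁻ F x‖ ≤ ∫ ξ, ‖F ξ‖ := by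
  rw [Real.fourierInv_eq]
  refine (norm_integral_le_integral_norm _).trans_eq (by simp)

/-- The `L²` Fourier transform, defined by density, is the distributional one. -/
theorem integral_mul_fourier_toLp {f : ℝ → ℂ} (hf : MemLp f 2) (φ : SchwartzMap ℝ ℂ) :
    ∫ ξ, φ ξ • (𝓕 (hf.toLp f) : Lp ℂ 2 (volume : Measure ℝ)) ξ =
      ∫ x, (𝓕 φ : SchwartzMap ℝ ℂ) x • f x := by
  have h := congrArg (fun T => T φ) (Lp.fourier_toTemperedDistribution_eq (hf.toLp f))
  simp only [TemperedDistribution.fourier_apply, Lp.toTemperedDistribution_apply] at h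
  rw [← h]
  refine integral_congr_ae ?_
  filter_upwards [hf.coeFn_toLp] with x hx
  rw [hx]

/-- If the inverse Fourier integral of an integrable, band-supported `F` is square-integrable, it
lies in the Paley-Wiener space. No square-integrability of `F` is assumed, so convolutions of spectra
qualify without an `L²` estimate. -/
theorem fourierInv_mem_paleyWiener {γ : ℝ} {F : ℝ → ℂ} (hF : Integrable F)
    (hsupp : ∀ ξ, 2 * Real.pi * ξ ∉ Set.Icc (-γ) γ → F ξ = 0) (h2 : MemLp (𝓕⁻ F) 2) :
    𝓕⁻ F ∈ PaleyWiener γ := by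
  refine ⟨continuous_fourierInv hF, h2, ?_⟩
  have : (𝓕 (h2.toLp (𝓕⁻ F)) : Lp ℂ 2 (volume : Measure ℝ)) =ᵐ[volume] F := by
    refine ae_eq_of_forall_schwartz ((Lp.memLp _).locallyIntegrable (by norm_num))
      hF.locallyIntegrable fun φ => ?_
    rw [integral_mul_fourier_toLp, integral_fourierInv_mul_fourier_schwartz hF]
  filter_upwards [this] with ξ hξ h
  rw [hξ, hsupp ξ h]

theorem two_pi_mul_mem_Icc_iff {γ ξ : ℝ} :
    2 * Real.pi * ξ ∈ Set.Icc (-γ) γ ↔ ξ ∈ Set.Icc (-(γ / (2 * Real.pi))) (γ / (2 * Real.pi)) := by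
  have : 0 < 2 * Real.pi := by positivity
  rw [Set.mem_Icc, Set.mem_Icc, ← neg_div, div_le_iff₀' this, le_div_iff₀' this]

/-- Every Paley-Wiener function is, at every point, the Fourier integral of a spectrum that vanishes
everywhere outside the band. -/
theorem exists_eq_fourierInv_of_mem_paleyWiener {γ : ℝ} {f : ℝ → ℂ} (hf : f ∈ PaleyWiener γ) :
    ∃ F : ℝ → ℂ, Integrable F ∧ MemLp F 2 ∧
      (∀ ξ, 2 * Real.pi * ξ ∉ Set.Icc (-γ) γ → F ξ = 0) ∧ f = 𝓕⁻ F := by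
  obtain ⟨hcont, h2, hsupp⟩ := hf
  set S : Set ℝ := Set.Icc (-(γ / (2 * Real.pi))) (γ / (2 * Real.pi))
  set F₀ : Lp ℂ 2 (volume : Measure ℝ) := 𝓕 (h2.toLp f)
  have hS : MeasurableSet S := measurableSet_Icc
  have hF2 : MemLp (S.indicator F₀) 2 := (Lp.memLp F₀).indicator hS
  have hF1 : Integrable (S.indicator F₀) := by
    rw [integrable_indicator_iff hS]
    have : IsFiniteMeasure (volume.restrict S) := ⟨by simp [S]⟩
    exact ((Lp.memLp F₀).restrict S).integrable (by norm_num)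
  have hae : (S.indicator F₀ : ℝ → ℂ) =ᵐ[volume] F₀ := by
    filter_upwards [hsupp] with ξ hξ
    by_cases h : ξ ∈ S
    · simp [h]
    · rw [Set.indicator_of_notMem h, hξ (mt two_pi_mul_mem_Icc_iff.1 h)]
  refine ⟨S.indicator F₀, hF1, hF2, fun ξ hξ => Set.indicator_of_notMem
    (mt two_pi_mul_mem_Icc_iff.2 hξ) _, ?_⟩
  refine (Continuous.ae_eq_iff_eq volume hcont (continuous_fourierInv hF1)).1 ?_
  refine ae_eq_of_forall_schwartz (h2.locallyIntegrable (by norm_num))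
    (continuous_fourierInv hF1).locallyIntegrable fun φ => ?_
  obtain ⟨ψ, rfl⟩ : ∃ ψ : SchwartzMap ℝ ℂ, 𝓕 ψ = φ :=
    ⟨𝓕⁻ φ, FourierTransform.fourier_fourierInv_eq φ⟩
  rw [integral_fourierInv_mul_fourier_schwartz hF1, ← integral_mul_fourier_toLp h2]
  refine integral_congr_ae ?_
  filter_upwards [hae] with ξ hξ
  rw [hξ]

/-! ### Closure properties of Paley-Wiener spaces -/

theorem PaleyWiener.continuous {γ : ℝ} {f : ℝ → ℂ} (hf : f ∈ PaleyWiener γ) : Continuous f := hf.1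

theorem PaleyWiener.memLp {γ : ℝ} {f : ℝ → ℂ} (hf : f ∈ PaleyWiener γ) : MemLp f 2 := hf.2.1

theorem PaleyWiener.add_mem {γ : ℝ} {f g : ℝ → ℂ} (hf : f ∈ PaleyWiener γ)
    (hg : g ∈ PaleyWiener γ) :
    f + g ∈ PaleyWiener γ := by
  obtain ⟨hfc, hf2, hfs⟩ := hf
  obtain ⟨hgc, hg2, hgs⟩ := hg
  refine ⟨hfc.add hgc, hf2.add hg2, ?_⟩
  rw [MemLp.toLp_add hf2 hg2, FourierTransform.fourier_add]
  filter_upwards [hfs, hgs, Lp.coeFn_add (𝓕 (hf2.toLp f)) (𝓕 (hg2.toLp g))] with ξ h1 h2 h3 h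
  rw [h3, Pi.add_apply, h1 h, h2 h, add_zero]

theorem PaleyWiener.smul_mem {γ : ℝ} {f : ℝ → ℂ} (c : ℂ) (hf : f ∈ PaleyWiener γ) :
    c • f ∈ PaleyWiener γ := by
  obtain ⟨hfc, hf2, hfs⟩ := hf
  refine ⟨hfc.const_smul c, hf2.const_smul c, ?_⟩
  rw [MemLp.toLp_const_smul c hf2, FourierTransform.fourier_smul]
  filter_upwards [hfs, Lp.coeFn_smul c (𝓕 (hf2.toLp f))] with ξ h1 h3 h
  rw [h3, Pi.smul_apply, h1 h, smul_zero]

theorem PaleyWiener.zero_mem {γ : ℝ} : (0 : ℝ → ℂ) ∈ PaleyWiener γ := by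
  refine ⟨continuous_zero, MemLp.zero', ?_⟩
  have h : 𝓕 ((MemLp.zero' : MemLp (fun _ : ℝ => (0 : ℂ)) 2 volume).toLp _) =
      (0 : Lp ℂ 2 (volume : Measure ℝ)) := by
    rw [← norm_eq_zero, Lp.norm_fourier_eq, norm_eq_zero]
    exact MemLp.toLp_zero _
  filter_upwards [Lp.coeFn_zero ℂ 2 (volume : Measure ℝ)] with ξ h1 _
  exact (congrArg (fun u : Lp ℂ 2 (volume : Measure ℝ) => u ξ) h).trans h1

theorem PaleyWiener.sub_mem {γ : ℝ} {f g : ℝ → ℂ} (hf : f ∈ PaleyWiener γ)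
    (hg : g ∈ PaleyWiener γ) :
    f - g ∈ PaleyWiener γ := by
  simpa [sub_eq_add_neg] using PaleyWiener.add_mem hf (PaleyWiener.smul_mem (-1) hg)

theorem PaleyWiener.sum_mem {γ : ℝ} {ι : Type*} (s : Finset ι) {f : ι → ℝ → ℂ}
    (hf : ∀ i ∈ s, f i ∈ PaleyWiener γ) : ∑ i ∈ s, f i ∈ PaleyWiener γ :=
  Finset.sum_induction f (· ∈ PaleyWiener γ) (fun _ _ => PaleyWiener.add_mem)
    PaleyWiener.zero_mem hf

theorem fourierInv_translate (F : ℝ → ℂ) (b x : ℝ) :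
    𝓕⁻ (fun ξ => (Real.fourierChar (ξ * b) : ℂ) * F ξ) x = 𝓕⁻ F (x + b) := by
  rw [Real.fourierInv_eq, Real.fourierInv_eq]
  refine integral_congr_ae (ae_of_all _ fun ξ => ?_)
  simp only [RCLike.inner_apply, conj_trivial, Circle.smul_def, smul_eq_mul, add_mul,
    AddChar.map_add_eq_mul, Circle.coe_mul]
  rw [mul_assoc, mul_comm ξ b]

theorem PaleyWiener.translate_mem {γ : ℝ} {f : ℝ → ℂ} (hf : f ∈ PaleyWiener γ) (b : ℝ) :
    (fun x => f (x + b)) ∈ PaleyWiener γ := by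
  have h2 : MemLp (fun x => f (x + b)) 2 :=
    (PaleyWiener.memLp hf).comp_measurePreserving (measurePreserving_add_right volume b)
  obtain ⟨F, hF, -, hs, rfl⟩ := exists_eq_fourierInv_of_mem_paleyWiener hf
  have e : (fun x => 𝓕⁻ F (x + b)) = 𝓕⁻ (fun ξ => (Real.fourierChar (ξ * b) : ℂ) * F ξ) :=
    funext fun x => (fourierInv_translate F b x).symm
  rw [e] at h2 ⊢
  refine fourierInv_mem_paleyWiener ?_ (fun ξ hξ => by simp [hs ξ hξ]) h2
  refine hF.bdd_mul (c := 1) ?_ (ae_of_all _ fun ξ => (Circle.norm_coe _).le)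
  have : Continuous fun ξ : ℝ => (Real.fourierChar (ξ * b) : ℂ) :=
    by fun_prop
  exact this.aestronglyMeasurable

theorem conj_fourierInv (F : ℝ → ℂ) (x : ℝ) :
    star (𝓕⁻ F x) = 𝓕⁻ (fun ξ => star (F (-ξ))) x := by
  rw [Real.fourierInv_eq, Real.fourierInv_eq, ← integral_neg_eq_self]
  simp only [RCLike.star_def, ← integral_conj]
  refine integral_congr_ae (ae_of_all _ fun ξ => ?_)
  simp [Circle.smul_def, ← Circle.coe_inv_eq_conj, AddChar.map_neg_eq_inv]

theorem PaleyWiener.star_mem {γ : ℝ} {f : ℝ → ℂ} (hf : f ∈ PaleyWiener γ) :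
    (fun x => star (f x)) ∈ PaleyWiener γ := by
  have h2 : MemLp (fun x => star (f x)) 2 := (PaleyWiener.memLp hf).star
  obtain ⟨F, hF, -, hs, rfl⟩ := exists_eq_fourierInv_of_mem_paleyWiener hf
  simp only [conj_fourierInv] at h2 ⊢
  refine fourierInv_mem_paleyWiener ?_ (fun ξ hξ => ?_) h2
  · have := hF.comp_neg
    exact (memLp_one_iff_integrable.1 (memLp_one_iff_integrable.2 this).star)
  · rw [hs, star_zero]
    contrapose! hξ
    rw [Set.mem_Icc] at hξ ⊢
    constructor <;> linarith [hξ.1, hξ.2]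

open scoped Convolution in
/-- The spectrum of a product is the convolution of the spectra, so bandwidths add. -/
theorem PaleyWiener.mul_mem {γ δ : ℝ} {f g : ℝ → ℂ} (hf : f ∈ PaleyWiener γ)
    (hg : g ∈ PaleyWiener δ) : f * g ∈ PaleyWiener (γ + δ) := by
  have hf2 := PaleyWiener.memLp hf
  have hgm := (PaleyWiener.continuous hg).aestronglyMeasurable (μ := volume)
  obtain ⟨F, hF, -, hFs, rfl⟩ := exists_eq_fourierInv_of_mem_paleyWiener hf
  obtain ⟨G, hG, -, hGs, rfl⟩ := exists_eq_fourierInv_of_mem_paleyWiener hg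
  have h2 : MemLp (𝓕⁻ F * 𝓕⁻ G) 2 := by
    have : MemLp (𝓕⁻ G) ∞ :=
      memLp_top_of_bound hgm (∫ ξ, ‖G ξ‖) (ae_of_all _ (norm_fourierInv_le G))
    exact this.mul hf2
  have e : 𝓕⁻ F * 𝓕⁻ G = 𝓕⁻ (F ⋆[ContinuousLinearMap.mul ℂ ℂ] G) := by
    ext x
    simp only [Pi.mul_apply, Real.fourierInv_eq_fourier_neg, Real.fourier_mul_convolution_eq hF hG]
  rw [e] at h2 ⊢
  refine fourierInv_mem_paleyWiener (hF.integrable_convolution _ hG) (fun ξ hξ => ?_) h2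
  refine integral_eq_zero_of_ae (ae_of_all _ fun η => ?_)
  by_cases h : 2 * Real.pi * η ∈ Set.Icc (-γ) γ
  · have : G (ξ - η) = 0 := by
      refine hGs _ fun h' => hξ ?_
      rw [Set.mem_Icc] at h h' ⊢
      constructor <;> linarith [h.1, h.2, h'.1, h'.2]
    simp [this]
  · simp [hFs η h]

theorem structuredConv_mem_paleyWiener {γ : ℝ} {K : ℕ} (b : Fin K → ℝ) (v : Fin K → ℂ)
    {f : ℝ → ℂ} (hf : f ∈ PaleyWiener γ) : structuredConv b v f ∈ PaleyWiener γ := by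
  have : structuredConv b v f = ∑ k, star (v k) • fun x => f (x + b k) := by
    ext x; simp [structuredConv, Finset.sum_apply]
  rw [this]
  exact PaleyWiener.sum_mem _ fun k _ => PaleyWiener.smul_mem _ (PaleyWiener.translate_mem hf _)

/-! ### Uniqueness from samples -/

theorem IsSetOfSampling.eq_zero {γ : ℝ} {t : ℤ → ℝ} (ht : IsSetOfSampling γ t) {h : ℝ → ℂ}
    (hh : h ∈ PaleyWiener γ) (h0 : ∀ n, h (t n) = 0) : h = 0 := by
  obtain ⟨A, B, hA, -, H⟩ := ht
  have h1 : A * ∫ x, ‖h x‖ ^ 2 ≤ 0 := by simpa [h0] using (H h hh).2.1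
  have h2 : ∫ x, ‖h x‖ ^ 2 = 0 :=
    le_antisymm (nonpos_of_mul_nonpos_right h1 hA) (integral_nonneg fun x => by positivity)
  have h3 : Integrable fun x => ‖h x‖ ^ 2 :=
    (PaleyWiener.memLp hh).integrable_norm_pow (by norm_num)
  rw [integral_eq_zero_iff_of_nonneg (fun x => by positivity) h3] at h2
  refine (Continuous.ae_eq_iff_eq volume (PaleyWiener.continuous hh) continuous_zero).1 ?_
  filter_upwards [h2] with x hx
  simpa using hx

/-- A spectrum in `[-1/2, 1/2]` lives on a circle of length `1 / a ≥ 1`, and the values of its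
inverse transform on `aℤ` are, up to a factor, its Fourier coefficients there; if they vanish, so does the
function by Parseval. -/
theorem fourierInv_eq_zero_of_lattice {F : ℝ → ℂ} (h2 : MemLp F 2)
    (hs : ∀ ξ, 2 * Real.pi * ξ ∉ Set.Icc (-Real.pi) Real.pi → F ξ = 0) {a : ℝ} (ha : 0 < a)
    (ha1 : a ≤ 1) (hz : ∀ n : ℤ, 𝓕⁻ F (n * a) = 0) : 𝓕⁻ F = 0 := by
  set r : ℝ := 1 / (2 * a)
  have hr : 1 / 2 ≤ r := one_div_le_one_div_of_le (by positivity) (by linarith)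
  have hra : r - -r = 1 / a := by simp only [r]; field_simp; norm_num
  have hab : -r < r := by linarith
  -- The band is closed and the circle is cut at `-r`, so for `a = 1` the point `-r` is excluded.
  have hsupp : ∀ ξ, ξ ∉ Set.Ioc (-r) r → ξ ≠ -r → F ξ = 0 := by
    intro ξ hξ hne
    refine hs ξ fun h => hξ ?_
    have hpi := Real.pi_pos
    have h1 : -(1 / 2) ≤ ξ := by nlinarith [h.1]
    have h2 : ξ ≤ 1 / 2 := by nlinarith [h.2]
    exact ⟨lt_of_le_of_ne (by linarith) hne.symm, by linarith⟩
  have hF0 : (Set.Ioc (-r) r).indicator F =ᵐ[volume] F := by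
    filter_upwards [Measure.ae_ne volume (-r)] with ξ hne
    by_cases h : ξ ∈ Set.Ioc (-r) r
    · simp [h]
    · rw [Set.indicator_of_notMem h, hsupp ξ h hne]
  have hcoeff : ∀ n : ℤ, fourierCoeffOn hab F n = 0 := by
    intro n
    rw [fourierCoeffOn_eq_integral, intervalIntegral.integral_of_le hab.le]
    -- The period is `r - -r = 1 / a`, so the character `fourier (-n)` has frequency `-n * a`.
    have key : ∫ x in Set.Ioc (-r) r, fourier (-n) (x : AddCircle (r - -r)) • F x =
        𝓕⁻ F ((-n : ℤ) * a) := by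
      rw [← integral_indicator measurableSet_Ioc, Real.fourierInv_eq']
      refine integral_congr_ae ?_
      filter_upwards [hF0] with ξ hξ
      rw [← hξ]
      by_cases h : ξ ∈ Set.Ioc (-r) r
      · rw [Set.indicator_of_mem h, Set.indicator_of_mem h, fourier_coe_apply, hra]
        congr 2
        push_cast
        simp only [RCLike.inner_apply, conj_trivial]
        push_cast
        field_simp
      · simp [Set.indicator_of_notMem h]
    rw [key, hz, smul_zero]
  have hsum := hasSum_sq_fourierCoeffOn hab (h2.restrict (Set.Ioc (-r) r))
  simp only [hcoeff, norm_zero, ne_eq, OfNat.ofNat_ne_zero, not_false_eq_true, zero_pow] at hsum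
  have h0 := hsum.unique hasSum_zero
  rw [smul_eq_zero, or_iff_right (inv_ne_zero (by linarith)),
    intervalIntegral.integral_of_le hab.le,
    integral_eq_zero_iff_of_nonneg (fun x => by positivity)
      ((h2.restrict _).integrable_norm_pow (by norm_num))] at h0
  have hF : F =ᵐ[volume] 0 := by
    refine hF0.symm.trans ?_
    rw [EventuallyEq, ae_restrict_iff' measurableSet_Ioc] at h0
    filter_upwards [h0] with ξ hξ
    by_cases h : ξ ∈ Set.Ioc (-r) r
    · simpa [h] using hξ h
    · simp [h]
  ext x
  rw [Real.fourierInv_congr_ae hF, Real.fourierInv_eq]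
  simp

theorem PaleyWiener.eq_zero_of_lattice {f : ℝ → ℂ} (hf : f ∈ PaleyWiener Real.pi) {a : ℝ}
    (ha : 0 < a) (ha1 : a ≤ 1) (s : ℝ) (hz : ∀ n : ℤ, f (s + n * a) = 0) : f = 0 := by
  have hg := PaleyWiener.translate_mem hf s
  obtain ⟨F, -, h2, hs, e⟩ := exists_eq_fourierInv_of_mem_paleyWiener hg
  have h0 := fourierInv_eq_zero_of_lattice h2 hs ha ha1
    (fun n => by simpa only [← e, add_comm] using hz n)
  ext x
  have := congrFun (e.trans h0) (x - s)
  simpa using this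

/-! ### Zeros of Paley-Wiener functions -/

/-- The Fourier-Laplace transform of a compactly supported integrable function is entire. -/
theorem differentiable_integral_cexp_mul {F : ℝ → ℂ} (hF : Integrable F) {r : ℝ}
    (hs : ∀ ξ, r < |ξ| → F ξ = 0) :
    Differentiable ℂ fun z : ℂ => ∫ ξ : ℝ, Complex.exp (z * ξ) * F ξ := by
  intro z₀
  have hint : ∀ z : ℂ, AEStronglyMeasurable (fun ξ : ℝ => Complex.exp (z * ξ) * F ξ) volume :=
    fun z => (Continuous.aestronglyMeasurable (by fun_prop)).mul hF.aestronglyMeasurable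
  have hb : ∀ z : ℂ, ‖z‖ ≤ ‖z₀‖ + 1 → ∀ ξ : ℝ, |ξ| ≤ r →
      ‖Complex.exp (z * ξ)‖ ≤ Real.exp ((‖z₀‖ + 1) * r) := by
    intro z hz ξ hξ
    refine (Complex.norm_exp_le_exp_norm _).trans (Real.exp_le_exp.2 ?_)
    rw [norm_mul, Complex.norm_real, Real.norm_eq_abs]
    gcongr
  refine (hasDerivAt_integral_of_dominated_loc_of_deriv_le
    (F' := fun z ξ => Complex.exp (z * ξ) * ξ * F ξ)
    (bound := fun ξ => Real.exp ((‖z₀‖ + 1) * r) * r * ‖F ξ‖)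
    (Metric.ball_mem_nhds z₀ one_pos) (Eventually.of_forall hint) ?_ ?_ ?_
    (hF.norm.const_mul _) ?_).2.differentiableAt
  · refine (hF.norm.const_mul (Real.exp ((‖z₀‖ + 1) * r))).mono' (hint z₀) (ae_of_all _ fun ξ => ?_)
    rcases le_or_gt |ξ| r with h | h
    · rw [norm_mul]
      gcongr
      exact hb z₀ (by linarith) ξ h
    · simp [hs ξ h]
  · exact (Continuous.aestronglyMeasurable (by fun_prop)).mul hF.aestronglyMeasurable
  · refine ae_of_all _ fun ξ z hz => ?_
    rcases le_or_gt |ξ| r with h | h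
    · rw [norm_mul, norm_mul, Complex.norm_real, Real.norm_eq_abs]
      gcongr
      refine hb z ?_ ξ h
      have := norm_le_norm_add_norm_sub' z z₀
      rw [Metric.mem_ball, dist_eq_norm] at hz
      linarith
    · simp [hs ξ h]
  · refine ae_of_all _ fun ξ z _ => ?_
    have : HasDerivAt (fun z : ℂ => z * ξ) (ξ : ℂ) z := by
      simpa using (hasDerivAt_id z).mul_const (ξ : ℂ)
    exact this.cexp.mul_const _

theorem PaleyWiener.analyticOnNhd {γ : ℝ} {f : ℝ → ℂ} (hf : f ∈ PaleyWiener γ) :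
    AnalyticOnNhd ℝ f Set.univ := by
  obtain ⟨F, hF, -, hs, rfl⟩ := exists_eq_fourierInv_of_mem_paleyWiener hf
  have hsupp : ∀ ξ, γ / (2 * Real.pi) < |ξ| → F ξ = 0 := by
    refine fun ξ hξ => hs ξ fun h => hξ.not_ge (abs_le.2 (two_pi_mul_mem_Icc_iff.1 h))
  have hd := differentiable_integral_cexp_mul hF hsupp
  have ha : AnalyticOnNhd ℝ (fun z : ℂ => ∫ ξ : ℝ, Complex.exp (z * ξ) * F ξ) Set.univ :=
    fun z _ => (hd.analyticAt z).restrictScalars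
  have hl : AnalyticOnNhd ℝ (fun x : ℝ => 2 * Real.pi * Complex.I * (x : ℂ)) Set.univ :=
    fun x _ => analyticAt_const.mul (Complex.ofRealCLM.analyticAt x)
  have e : 𝓕⁻ F = (fun z : ℂ => ∫ ξ : ℝ, Complex.exp (z * ξ) * F ξ) ∘
      (fun x : ℝ => 2 * Real.pi * Complex.I * (x : ℂ)) := by
    ext x
    rw [Real.fourierInv_eq', Function.comp_apply]
    refine integral_congr_ae (ae_of_all _ fun ξ => ?_)
    simp only [RCLike.inner_apply, conj_trivial, smul_eq_mul]
    push_cast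
    ring_nf
  rw [e]
  exact ha.comp hl (Set.mapsTo_univ _ _)

theorem AnalyticOnNhd.countable_zeros {f : ℝ → ℂ} (hf : AnalyticOnNhd ℝ f Set.univ) (h0 : f ≠ 0) :
    {x | f x = 0}.Countable := by
  obtain ⟨x, hx⟩ := Function.ne_iff.1 h0
  have h : {x | f x = 0}ᶜ ∈ codiscreteWithin (Set.univ : Set ℝ) :=
    hf.preimage_zero_mem_codiscrete hx
  have := (isDiscrete_of_codiscreteWithin h).to_subtype
  rw [Set.inter_univ] at this
  exact TopologicalSpace.separableSpace_iff_countable.1 inferInstance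

/-! ### Subgroups of the line and their density -/

theorem countable_generatedGroup {K : ℕ} (c : Fin K → ℝ) :
    (generatedGroup c : Set ℝ).Countable := by
  refine (Set.countable_range fun n : Fin K → ℤ => ∑ i, n i • c i).mono fun x hx => ?_
  rw [SetLike.mem_coe, generatedGroup, ← Submodule.span_int_eq_addSubgroupClosure] at hx
  exact Submodule.mem_span_range_iff_exists_fun ℤ |>.1 hx

/-- A subgroup of `ℝ` is dense or equal to `aℤ` with `a ≥ 0`; `{0}` has density `0` and `aℤ` with
`a ≥ 1` has density at most `1`. For both of these `[0, h]` contains at most `h + 1` elements. -/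
theorem dense_or_exists_mem_of_hasBeurlingDensity {G : AddSubgroup ℝ} {D : ℝ≥0∞} (hD : 1 < D)
    (h : HasBeurlingDensity (G : Set ℝ) D) :
    Dense (G : Set ℝ) ∨ ∃ a : ℝ, 0 < a ∧ a < 1 ∧ a ∈ G := by
  refine or_iff_not_imp_left.2 fun hG => ?_
  obtain ⟨a₀, ha₀⟩ := G.dense_or_cyclic.resolve_left hG
  obtain ⟨a, ha, rfl⟩ : ∃ a : ℝ, 0 ≤ a ∧ G = AddSubgroup.zmultiples a := by
    refine ⟨|a₀|, abs_nonneg _, ?_⟩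
    rw [ha₀, ← AddSubgroup.zmultiples_eq_closure]
    rcases abs_choice a₀ with h | h <;> rw [h]
    exact AddSubgroup.zmultiples_neg.symm
  by_contra! hcon
  have ha' : a = 0 ∨ 1 ≤ a := by
    rcases ha.eq_or_lt with h | h
    · exact Or.inl h.symm
    · by_contra! h1
      exact hcon a h h1.2 (AddSubgroup.mem_zmultiples a)
  have hcount : ∀ x : ℝ, 0 ≤ x →
      (((AddSubgroup.zmultiples a : Set ℝ) ∩ Set.Icc 0 (0 + x)).encard : ℝ≥0∞)
      ≤ ENNReal.ofReal (x + 1) := by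
    intro x hx
    have hsub : (AddSubgroup.zmultiples a : Set ℝ) ∩ Set.Icc 0 (0 + x) ⊆
        (fun n : ℕ => (n : ℝ) * a) '' (Finset.range (⌊x⌋₊ + 1) : Set ℕ) := by
      rintro _ ⟨⟨n, rfl⟩, h0, h1⟩
      simp only [zsmul_eq_mul, zero_add] at h0 h1
      rcases ha' with rfl | ha'
      · exact ⟨0, by simp, by simp⟩
      have hn : (0 : ℝ) ≤ n := nonneg_of_mul_nonneg_left h0 (by linarith)
      lift n to ℕ using by exact_mod_cast hn
      rw [Int.cast_natCast] at h0 h1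
      refine ⟨n, ?_, by simp⟩
      rw [Finset.coe_range, Set.mem_Iio, Nat.lt_succ_iff]
      exact Nat.le_floor (by nlinarith)
    have hcard := (Set.encard_le_encard hsub).trans (Set.encard_image_le _ _)
    rw [Set.encard_coe_eq_coe_finsetCard, Finset.card_range] at hcard
    calc _ ≤ (((⌊x⌋₊ + 1 : ℕ) : ℕ∞) : ℝ≥0∞) := by exact_mod_cast hcard
      _ = ENNReal.ofReal ((⌊x⌋₊ + 1 : ℕ) : ℝ) := by
        rw [ENNReal.ofReal_natCast, ENat.toENNReal_coe]
      _ ≤ _ := ENNReal.ofReal_le_ofReal (by push_cast; linarith [Nat.floor_le hx])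
  have hlim : Tendsto (fun x : ℝ => ENNReal.ofReal (x + 1) / ENNReal.ofReal x) atTop (𝓝 1) := by
    have h1 : Tendsto (fun x : ℝ => ENNReal.ofReal (1 + x⁻¹)) atTop (𝓝 1) := by
      simpa using ENNReal.tendsto_ofReal (tendsto_inv_atTop_zero.const_add (1 : ℝ))
    refine h1.congr' ?_
    filter_upwards [eventually_gt_atTop 0] with x hx
    rw [← ENNReal.ofReal_div_of_pos hx]
    congr 1
    field_simp
  refine hD.not_ge (le_of_tendsto_of_tendsto h hlim ?_)
  filter_upwards [eventually_ge_atTop 0] with x hx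
  exact (iInf_le _ 0).trans (ENNReal.div_le_div_right (hcount x hx) _)

/-! ### Recovering the phase -/

/-- A coset of a group of Beurling density greater than one is a uniqueness set for `PW_π`. -/
theorem PaleyWiener.eq_zero_of_eqOn_coset {f : ℝ → ℂ} (hf : f ∈ PaleyWiener Real.pi)
    {G : AddSubgroup ℝ} {D : ℝ≥0∞} (hD : 1 < D) (hG : HasBeurlingDensity (G : Set ℝ) D) (s : ℝ)
    (hz : ∀ x ∈ G, f (s + x) = 0) : f = 0 := by
  rcases dense_or_exists_mem_of_hasBeurlingDensity hD hG with h | ⟨a, ha, ha1, haG⟩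
  · have := Continuous.ext_on h ((PaleyWiener.continuous hf).comp (continuous_const_add s))
      continuous_const (fun x hx => hz x hx)
    ext x
    simpa using congrFun this (x - s)
  · refine PaleyWiener.eq_zero_of_lattice hf ha ha1.le s fun n => hz _ ?_
    simpa using G.zsmul_mem haG n

theorem PaleyWiener.exists_forall_coset_ne_zero {γ : ℝ} {f : ℝ → ℂ} (hf : f ∈ PaleyWiener γ)
    (h0 : f ≠ 0) {S : Set ℝ} (hS : S.Countable) : ∃ s : ℝ, ∀ x ∈ S, f (s + x) ≠ 0 := by
  have hc : (⋃ x ∈ S, (fun s => s + x) ⁻¹' {y | f y = 0}).Countable :=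
    hS.biUnion fun x _ => (AnalyticOnNhd.countable_zeros (PaleyWiener.analyticOnNhd hf) h0).preimage
      (add_left_injective x)
  obtain ⟨s, hs⟩ := (hc.dense_compl ℝ).nonempty
  refine ⟨s, fun x hx h => hs ?_⟩
  simp only [Set.mem_iUnion]
  exact ⟨x, hx, h⟩

/-- Functions of equal modulus whose quotient has all periods `c k` agree up to a phase. The
quotient is constant on a coset `s + G` free of zeros, and the coset is a uniqueness set. -/
theorem eq_smul_of_cross_ratio {f g : ℝ → ℂ} (hf : f ∈ PaleyWiener Real.pi)
    (hg : g ∈ PaleyWiener Real.pi) (hnorm : ∀ s, ‖f s‖ = ‖g s‖) {K : ℕ} (c : Fin K → ℝ)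
    {D : ℝ≥0∞} (hD : 1 < D) (hG : HasBeurlingDensity (generatedGroup c : Set ℝ) D)
    (hper : ∀ k s, f (s + c k) * g s = f s * g (s + c k)) :
    ∃ q : ℂ, ‖q‖ = 1 ∧ f = q • g := by
  -- If `g = 0` then `f = 0`, and any phase will do.
  by_cases hg0 : g = 0
  · refine ⟨1, norm_one, ?_⟩
    ext s
    simpa [hg0] using hnorm s
  obtain ⟨s, hs⟩ := PaleyWiener.exists_forall_coset_ne_zero hg hg0 (countable_generatedGroup c)
  -- The ratio `f / g` is `G`-periodic on the coset `s + G`, which carries no zero of `g`.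
  have key : ∀ x ∈ generatedGroup c, ∀ y ∈ generatedGroup c,
      f (s + (x + y)) / g (s + (x + y)) = f (s + y) / g (s + y) := by
    intro x hx
    induction hx using AddSubgroup.closure_induction with
    | mem x hx =>
      intro y hy
      have hxG := AddSubgroup.subset_closure hx
      obtain ⟨k, rfl⟩ := hx
      rw [div_eq_div_iff (hs _ (add_mem hxG hy)) (hs _ hy), add_comm (c k), ← add_assoc]
      exact hper k (s + y)
    | zero => simp
    | add x z hx hz ihx ihz =>
      intro y hy
      rw [add_assoc, ihx _ (add_mem hz hy), ihz y hy]
    | neg x hx ih =>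
      intro y hy
      rw [← ih _ (add_mem (neg_mem hx) hy), add_neg_cancel_left]
  have hs0 : g s ≠ 0 := by simpa using hs 0 (zero_mem _)
  refine ⟨f s / g s, by rw [norm_div, hnorm, div_self (norm_ne_zero_iff.2 hs0)], ?_⟩
  refine sub_eq_zero.1 (PaleyWiener.eq_zero_of_eqOn_coset
    (PaleyWiener.sub_mem hf (PaleyWiener.smul_mem _ hg)) hD hG s fun x hx => ?_)
  have := key x hx 0 (zero_mem _)
  rw [add_zero, add_zero] at this
  rw [Pi.sub_apply, Pi.smul_apply, smul_eq_mul, ← this, div_mul_cancel₀ _ (hs x hx), sub_self]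

/-- The difference `|u|² - |w|²` has twice the bandwidth of `u` and `w`, so its zeros on a set of
sampling for the doubled band propagate to the whole line. -/
theorem PaleyWiener.norm_eq_of_isSetOfSampling {γ : ℝ} {t : ℤ → ℝ}
    (ht : IsSetOfSampling (2 * γ) t)
    {u w : ℝ → ℂ} (hu : u ∈ PaleyWiener γ) (hw : w ∈ PaleyWiener γ)
    (h : ∀ n, ‖u (t n)‖ = ‖w (t n)‖) (s : ℝ) : ‖u s‖ = ‖w s‖ := by
  have hsq : ∀ z : ℂ, z * star z = ((‖z‖ ^ 2 : ℝ) : ℂ) := fun z => by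
    rw [RCLike.star_def, Complex.mul_conj, Complex.normSq_eq_norm_sq]
  have hmem := PaleyWiener.sub_mem (PaleyWiener.mul_mem hu (PaleyWiener.star_mem hu))
    (PaleyWiener.mul_mem hw (PaleyWiener.star_mem hw))
  rw [← two_mul] at hmem
  have h0 := congrFun (ht.eq_zero hmem fun n => by
    simp only [Pi.sub_apply, Pi.mul_apply, hsq, h, sub_self]) s
  simp only [Pi.sub_apply, Pi.mul_apply, hsq, Pi.zero_apply, sub_eq_zero, Complex.ofReal_inj] at h0
  exact (sq_eq_sq₀ (norm_nonneg _) (norm_nonneg _)).1 h0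

theorem mainTheorem2 {K M : ℕ} [NeZero K]
    (V : Matrix (Fin K) (Fin M) ℂ) (hV : MatrixDoesPhaseRetrieval V)
    (b : Fin K → ℝ)
    (hb : ∃ D : ℝ≥0∞, 1 < D ∧
      HasBeurlingDensity (generatedGroup (fun k => b k - b 0) : Set ℝ) D)
    (t : ℤ → ℝ) (ht : IsSetOfSampling (2 * Real.pi) t) :
    DoesPhaseRetrievalOn (PaleyWiener Real.pi)
      (fun (i : Fin M × ℤ) (f : ℝ → ℂ) => structuredConv b (V.col i.1) f (t i.2)) := by
  intro f hf g hg hfg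
  obtain ⟨D, hD, hG⟩ := hb
  have hvec : ∀ s, ∃ θ : ℝ, (fun k => f (s + b k)) =
      Complex.exp (θ * Complex.I) • fun k => g (s + b k) := by
    refine fun s => hV _ _ fun m => ?_
    have := PaleyWiener.norm_eq_of_isSetOfSampling ht
      (structuredConv_mem_paleyWiener b (V.col m) hf)
      (structuredConv_mem_paleyWiener b (V.col m) hg) (fun n => hfg (m, n)) s
    simpa [structuredConv, dotProduct, mul_comm] using this
  -- Both hypotheses come from the vector identity at `s - b 0`: its entry `0` has argument `s`.
  refine eq_smul_of_cross_ratio hf hg (fun s => ?_) _ hD hG fun k s => ?_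
  · obtain ⟨θ, hθ⟩ := hvec (s - b 0)
    have := congrArg norm (congrFun hθ 0)
    simpa [Complex.norm_exp_ofReal_mul_I] using this
  · obtain ⟨θ, hθ⟩ := hvec (s - b 0)
    have h0 := congrFun hθ 0
    have hk := congrFun hθ k
    simp only [Pi.smul_apply, smul_eq_mul, sub_add_cancel] at h0 hk
    rw [show s + (b k - b 0) = s - b 0 + b k by ring, h0, hk]
    ring
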